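/- Let $p$ be a prime. For integers $1\le a\le b$ and any field $F$ of characteristic $p$, let $J_k$ denote the unipotent $k\times k$ Jordan block over $F$ (entries $1$ on the diagonal and the superdiagonal, $0$ elsewhere). The Jordan canonical form of $J_a\otimes J_b$ is $\bigoplus_{i=1}^{a}J_{\lambda_i}$ for a unique sequence $\lambda_1\ge\cdots\ge\lambda_a>0$, which depends only on $(a,b,p)$, and $n\mapsto (a+1-n)+b-\lambda_n$ is a permutation $\pi(a,b,p)$ of $[a]=\{1,\dots,a\}$, the Norman permutation. For $1\le i\le j\le a$ let $\mathrm{Rev}(i,j)$ be the permutation of $[a]$ which sends $n$ to $i+j-n$ for $i\le n\le j$ and fixes all other points. For $k<a$, permutations of $[k]$ are regarded as permutations of $[a]$ fixing $k+1,\dots,a$. Permutations act on the right, so that $f\circ g$ is $f$ followed by $g$, and $f^g=g^{-1}\circ f\circ g$. Let $r,s_0,s_1,m$ be integers with $m\ge 0$, $1\le s_0<p$ and $1\le s_1<r<p^m$. Then the following hold, where the Norman permutations involved are well defined in the above sense. (a) If $s=s_0p^m+s_1$, then $\pi(r,s,p)=\pi(s_1,r,p)\circ\mathrm{Rev}(s_1+1,r)$.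 (b) If $s'=(s_0+1)p^m-s_1$, then $\pi(r,s',p)=\mathrm{Rev}(1,r-s_1)\circ\pi(s_1,r,p)^{\mathrm{Rev}(1,r)}$. -/

import Mathlib

/-!  Permutations of `[r] = {1, ..., r}` are represented by permutations of `ℕ` which fix every
`n ∉ {1, ..., r}`; so `S_m` is the subgroup of `S_n`, for `m < n`, which fixes
`m + 1, ..., n`. -/

namespace NormanPermutation

/-- The nilpotent Jordan block of degree `r`: entry `1` in the positions `(i, i+1)`, and `0`
elsewhere. -/
def nilBlock (F : Type*) [Field F] (r : ℕ) : Matrix (Fin r) (Fin r) F :=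
  Matrix.of fun i j => if (i : ℕ) + 1 = (j : ℕ) then 1 else 0

/-- The unipotent Jordan block `J_r = I_r + N_r`. -/
def jordanBlock (F : Type*) [Field F] (r : ℕ) : Matrix (Fin r) (Fin r) F :=
  1 + nilBlock F r

/-- Similarity of two square matrices, whose index types may differ: `B = P * A * P⁻¹`,
where `Q` is the inverse of `P`. -/
def AreSimilar {F : Type*} [Field F] {ι κ : Type*} [Fintype ι] [Fintype κ]
    [DecidableEq ι] [DecidableEq κ] (A : Matrix ι ι F) (B : Matrix κ κ F) : Prop :=
  ∃ (P : Matrix κ ι F) (Q : Matrix ι κ F), P * Q = 1 ∧ Q * P = 1 ∧ P * A * Q = B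

/-- `lam = (λ_1 ≥ ⋯ ≥ λ_r > 0)` is the partition for which the Jordan canonical form of
`J_r ⊗ J_s` over `F` is the block diagonal matrix `J_{λ_1} ⊕ ⋯ ⊕ J_{λ_r}`.
The part `λ_{i+1}` is `lam i`, for `i : Fin r`. -/
def IsJordanPartition (F : Type*) [Field F] (r s : ℕ) (lam : Fin r → ℕ) : Prop :=
  Antitone lam ∧ (∀ i, 0 < lam i) ∧
    AreSimilar (Matrix.kronecker (jordanBlock F r) (jordanBlock F s))
      (Matrix.blockDiagonal' fun i : Fin r => jordanBlock F (lam i))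

/-- `σ` is the permutation of `{1, ..., r}` which sends `n` to `(r + 1 - n) + s - λ_n`, where
`λ` is the Jordan partition of `J_r ⊗ J_s` over `F`. -/
def IsNormanPerm (F : Type*) [Field F] (r s : ℕ) (σ : Equiv.Perm ℕ) : Prop :=
  ∃ lam : Fin r → ℕ, IsJordanPartition F r s lam ∧
    (∀ i : Fin r, ((σ ((i : ℕ) + 1) : ℕ) : ℤ)
      = ((r : ℤ) + 1 - ((i : ℤ) + 1)) + (s : ℤ) - (lam i : ℤ)) ∧
    (∀ n : ℕ, n ∉ Finset.Icc 1 r → σ n = n)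

/-- The Norman permutation `π(r, s, p)`, formed over the prime field of characteristic `p`.
(That it exists, is unique, and is the same over each field of characteristic `p` has to be
proved where it is used.) -/
noncomputable def normanPerm (p : ℕ) [Fact p.Prime] (r s : ℕ) : Equiv.Perm ℕ :=
  Classical.epsilon fun σ => IsNormanPerm (ZMod p) r s σ

/-- The map which reverses the sequence `(i, i+1, ..., j)` and fixes all other numbers. -/
def revFun (i j n : ℕ) : ℕ := if i ≤ n ∧ n ≤ j then i + j - n else n

theorem revFun_involutive (i j : ℕ) : Function.Involutive (revFun i j) := by
  intro n
  unfold revFun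
  split_ifs <;> omega

/-- The reversal permutation `Rev(i, j)`. -/
def Rev (i j : ℕ) : Equiv.Perm ℕ := (revFun_involutive i j).toPerm

end NormanPermutation

/-! The matrix `J_a ⊗ J_b` is multiplication by `(1 + x) (1 + y)` on `F[x, y] / (x^a, y^b)`, which
is similar to multiplication by `1 + x + y`. As `x + y` is homogeneous, its Jordan chains can be
started in forms. Let `λ_n` be the least `k` such that `(x + y)^k` kills some form of degree `n`
which is not divisible by `x + y`. Chains of length `λ_n` which start in the degrees
`n = 0, ..., a - 1` are linearly independent: a relation between them could be divided by a power
of `x + y`, giving a shorter chain. Moreover the degrees `n + λ_n` are distinct, so that they are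
`b, ..., a + b - 1` in some order and `∑ λ_n = a b`; hence the chains form a Jordan basis when
`a ≤ b`. The symmetry between `a` and `b` gives the same `λ_n` for `J_b ⊗ J_a`, with `λ_n = 0` if
`n ≥ min(a, b)`.

Setting `y = 1` turns `x + y` into `1 + X`, and `(1 + X)^Q ≡ 1` modulo `X^r` if `Q` is a multiple
of `p^m ≥ r`. So for `F[x, y] / (x^r, y^t)` a generator which is killed by the power `λ_n` is killed
by the power `Q + λ_n` once `y^t` is replaced by `y^(Q + t)`. For `y^(Q - t)`, what remains of
`(1 + X)^(λ_n) f` below the degree `n + λ_n - t + 1` is a generator which is killed by the power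
`Q - λ_n`. These upper bounds for the new chain lengths have the correct sum, so they are
attained. -/

namespace NormanPermutation

section CongruenceModXPow

open Polynomial

variable {R : Type*} [CommRing R]

theorem natDegree_one_add_X_pow_mul_le {n k : ℕ} {f : R[X]} (hf : f.natDegree ≤ n) :
    ((1 + X) ^ k * f).natDegree ≤ n + k := by
  have h : (1 + X : R[X]).natDegree ≤ 1 := by compute_degree
  simpa [add_comm] using natDegree_mul_le_of_le (natDegree_pow_le_of_le k h) hf

theorem coeff_one_add_X_mul_succ (f : R[X]) (i : ℕ) :
    ((1 + X) * f).coeff (i + 1) = f.coeff (i + 1) + f.coeff i := by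
  rw [add_mul, one_mul, coeff_add, coeff_X_mul]

theorem X_pow_dvd_sub_iff {r : ℕ} {f g : R[X]} :
    X ^ r ∣ f - g ↔ ∀ i < r, f.coeff i = g.coeff i := by
  simp only [X_pow_dvd_iff, coeff_sub, sub_eq_zero]

theorem X_pow_dvd_of_dvd_one_add_X_pow_mul {r k : ℕ} {f : R[X]} (h : X ^ r ∣ (1 + X) ^ k * f) :
    X ^ r ∣ f :=
  IsCoprime.dvd_of_dvd_mul_left (IsCoprime.pow ⟨-1, 1, by ring⟩) h

theorem exists_natDegree_le_forall_coeff_eq (f : R[X]) (d : ℕ) :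
    ∃ g : R[X], g.natDegree ≤ d ∧ ∀ i ≤ d, g.coeff i = f.coeff i := by
  refine ⟨PowerSeries.trunc (d + 1) f, Nat.lt_succ_iff.1 (PowerSeries.natDegree_trunc_lt _ d),
    fun i hi => ?_⟩
  rw [PowerSeries.coeff_trunc, if_pos (Nat.lt_succ_of_le hi), coeff_coe]

theorem X_pow_dvd_one_add_X_pow_sub_one (p : ℕ) [Fact p.Prime] [CharP R p] {m r : ℕ}
    (hr : r ≤ p ^ m) (N : ℕ) : (X : R[X]) ^ r ∣ (1 + X) ^ (N * p ^ m) - 1 := by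
  have hpow : (1 + X : R[X]) ^ (N * p ^ m) = (1 + X ^ p ^ m) ^ N := by
    rw [mul_comm, pow_mul, add_pow_char_pow, one_pow]
  rw [hpow]
  have hdvd : (X : R[X]) ^ p ^ m ∣ (1 + X ^ p ^ m) ^ N - 1 := by
    have h := sub_dvd_pow_sub_pow (1 + X ^ p ^ m : R[X]) 1 N
    rwa [add_sub_cancel_left, one_pow] at h
  exact (pow_dvd_pow X hr).trans hdvd

theorem coeff_one_add_X_pow_mul_of_dvd {r Q i : ℕ} (hQ : (X : R[X]) ^ r ∣ (1 + X) ^ Q - 1)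
    (hi : i < r) (f : R[X]) : ((1 + X) ^ Q * f).coeff i = f.coeff i := by
  refine X_pow_dvd_sub_iff.1 ?_ i hi
  rw [← sub_one_mul]
  exact hQ.mul_right f

theorem reflect_one_add_X_pow_mul {n k : ℕ} {f : R[X]} (hf : f.natDegree ≤ n) :
    reflect (n + k) ((1 + X) ^ k * f) = (1 + X) ^ k * reflect n f := by
  have hdeg : (1 + X : R[X]).natDegree ≤ 1 := by compute_degree
  have hone : reflect 1 (1 + X : R[X]) = 1 + X := by
    rw [reflect_add, reflect_one, reflect_one_X, pow_one, add_comm]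
  induction k with
  | zero => simp only [add_zero, pow_zero, one_mul]
  | succ k ih =>
    rw [pow_succ', mul_assoc, ← add_assoc, add_comm _ 1,
      reflect_mul _ _ hdeg (natDegree_one_add_X_pow_mul_le hf), ih, hone, mul_assoc]

theorem eval_neg_one_reflect_eq_zero_iff {n : ℕ} {f : R[X]} (hf : f.natDegree ≤ n) :
    (reflect n f).eval (-1) = 0 ↔ f.eval (-1) = 0 := by
  let _ : Invertible (-1 : R) := ⟨-1, by simp, by simp⟩
  exact eval₂_reflect_eq_zero_iff (RingHom.id R) (-1) n f hf

end CongruenceModXPow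

section ChainLength

open Polynomial

variable {F : Type*} [Field F]

/-- The form `∑ fᵢ xⁱ y^(d - i)` of degree `d`, encoded by `f = ∑ fᵢ Xⁱ` (that is, `y = 1`), lies
in the ideal `(x^a, y^b)`. -/
def VanishesInDegree (a b d : ℕ) (f : F[X]) : Prop :=
  ∀ i, i < a → d < b + i → f.coeff i = 0

/-- `f` encodes a form of degree `n` which is not divisible by `x + y` and which `(x + y)^k`
multiplies into `(x^a, y^b)`. As `x + y` becomes `1 + X`, non-divisibility is `f(-1) ≠ 0`. -/
structure IsChainGenerator (a b n k : ℕ) (f : F[X]) : Prop where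
  natDegree_le : f.natDegree ≤ n
  eval_ne_zero : f.eval (-1) ≠ 0
  vanishes : VanishesInDegree a b (n + k) ((1 + X) ^ k * f)

variable (F) in
/-- The length of the Jordan chain of `x + y` on `F[x, y] / (x^a, y^b)` which starts in
degree `n`. For `n < a ≤ b` it is the part `λ_(n+1)` of the Jordan partition of `J_a ⊗ J_b`. -/
noncomputable def chainLength (a b n : ℕ) : ℕ :=
  sInf {k | ∃ f : F[X], IsChainGenerator a b n k f}

/-- The coefficient of `x^(d + 1 - b) y^(b - 1)` is the pivot: the coefficients of `(1 + X) f`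
being zero, it determines all later coefficients of `f`. -/
theorem VanishesInDegree.of_one_add_X_mul {a b d : ℕ} {f : F[X]} (hbd : b ≤ d + 1)
    (h : VanishesInDegree a b (d + 1) ((1 + X) * f)) (hpivot : f.coeff (d + 1 - b) = 0) :
    VanishesInDegree a b d f := by
  intro i hi hd
  obtain ⟨k, rfl⟩ : ∃ k, i = d + 1 - b + k := ⟨i - (d + 1 - b), by omega⟩
  clear hd
  induction k with
  | zero => exact hpivot
  | succ k ih =>
    have hsum := h (d + 1 - b + k + 1) (by omega) (by omega)
    rwa [coeff_one_add_X_mul_succ, ih (by omega), add_zero] at hsum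

theorem isChainGenerator_one {a b n k : ℕ} (h : a + b ≤ n + k + 1) :
    IsChainGenerator a b n k (1 : F[X]) :=
  ⟨by simp, by simp, fun i hi hd => by omega⟩

namespace IsChainGenerator

variable {a b n k : ℕ} {f : F[X]}

theorem X_mul (h : IsChainGenerator a b n k f) : IsChainGenerator a b (n + 1) k (X * f) := by
  refine ⟨?_, by simpa using h.eval_ne_zero, ?_⟩
  · exact (natDegree_mul_le_of_le natDegree_X_le h.natDegree_le).trans_eq (add_comm 1 n)
  · rw [mul_left_comm]
    rintro (_ | i) hi hd
    · exact coeff_X_mul_zero _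
    · rw [coeff_X_mul]
      exact h.vanishes i (by omega) (by omega)

theorem chainLength_le (h : IsChainGenerator a b n k f) : chainLength F a b n ≤ k :=
  Nat.sInf_le ⟨f, h⟩

theorem reflect (h : IsChainGenerator a b n k f) :
    IsChainGenerator b a n k (f.reflect n) := by
  refine ⟨natDegree_reflect_le.trans (max_le le_rfl h.natDegree_le),
    (eval_neg_one_reflect_eq_zero_iff h.natDegree_le).not.2 h.eval_ne_zero, fun i hi hd => ?_⟩
  rw [← reflect_one_add_X_pow_mul h.natDegree_le, coeff_reflect]
  rcases le_or_gt i (n + k) with hik | hik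
  · rw [revAt_le hik]
    exact h.vanishes _ (by omega) (by omega)
  · rw [revAt_eq_self_of_lt hik]
    exact coeff_eq_zero_of_natDegree_lt
      ((natDegree_one_add_X_pow_mul_le h.natDegree_le).trans_lt hik)

theorem le_add (h : IsChainGenerator a b n k f) (hn : n < a) : b ≤ n + k := by
  by_contra! hlt
  have hdvd : X ^ a ∣ f := X_pow_dvd_of_dvd_one_add_X_pow_mul (k := k)
    (X_pow_dvd_iff.2 fun i hi => h.vanishes i hi (by omega))
  have hzero : f = 0 := eq_zero_of_dvd_of_natDegree_lt hdvd
    (by rw [natDegree_X_pow]; exact h.natDegree_le.trans_lt hn)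
  exact h.eval_ne_zero (by simp [hzero])

/-- Two chains ending in the same degree: either the first one is shorter than stated, or
subtracting a multiple of it from the second one makes the pivot coefficient vanish. -/
theorem exists_pred {j l : ℕ} {g : F[X]} (hj : j ≠ 0) (hb : b ≤ n + j + l + 1)
    (hf : IsChainGenerator a b n (l + j + 1) f) (hg : IsChainGenerator a b (n + j) (l + 1) g) :
    (∃ u : F[X], IsChainGenerator a b n (l + j) u) ∨
      ∃ u : F[X], IsChainGenerator a b (n + j) l u := by
  set u := (1 + X) ^ (l + j) * f with hu
  set w := (1 + X) ^ l * g with hw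
  have hvu : VanishesInDegree a b (n + j + l + 1) ((1 + X) * u) := by
    rw [hu, ← mul_assoc, ← pow_succ', show n + j + l + 1 = n + (l + j + 1) by omega]
    exact hf.vanishes
  have hvw : VanishesInDegree a b (n + j + l + 1) ((1 + X) * w) := by
    rw [hw, ← mul_assoc, ← pow_succ']
    exact hg.vanishes
  set c := u.coeff (n + j + l + 1 - b)
  set e := w.coeff (n + j + l + 1 - b)
  by_cases hc : c = 0
  · refine .inl ⟨f, hf.natDegree_le, hf.eval_ne_zero, ?_⟩
    rw [show n + (l + j) = n + j + l by omega]
    exact hvu.of_one_add_X_mul hb hc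
  · refine .inr ⟨e • ((1 + X) ^ j * f) - c • g, ?_, ?_, ?_⟩
    · refine (natDegree_sub_le_iff_left ((natDegree_smul_le c g).trans hg.natDegree_le)).2 ?_
      exact (natDegree_smul_le e _).trans (natDegree_one_add_X_pow_mul_le hf.natDegree_le)
    · simp [hj, hc, hg.eval_ne_zero]
    · have hcomb : (1 + X) ^ l * (e • ((1 + X) ^ j * f) - c • g) = e • u - c • w := by
        rw [hu, hw, pow_add, mul_sub, mul_smul_comm, mul_smul_comm, mul_assoc]
      rw [hcomb]
      refine VanishesInDegree.of_one_add_X_mul hb (fun i hi hd => ?_) ?_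
      · rw [mul_sub, mul_smul_comm, mul_smul_comm, coeff_sub, coeff_smul, coeff_smul,
          hvu i hi hd, hvw i hi hd, smul_zero, smul_zero, sub_zero]
      · rw [coeff_sub, coeff_smul, coeff_smul]
        exact sub_eq_zero.2 (mul_comm e c)

end IsChainGenerator

theorem exists_isChainGenerator_chainLength (a b n : ℕ) :
    ∃ f : F[X], IsChainGenerator a b n (chainLength F a b n) f :=
  Nat.sInf_mem (s := {k | ∃ f : F[X], IsChainGenerator a b n k f})
    ⟨a + b, 1, isChainGenerator_one (by omega)⟩

theorem chainLength_antitone (a b : ℕ) : Antitone (chainLength F a b) :=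
  antitone_nat_of_succ_le fun n =>
    let ⟨_, hf⟩ := exists_isChainGenerator_chainLength a b n
    hf.X_mul.chainLength_le

theorem chainLength_comm (a b n : ℕ) : chainLength F a b n = chainLength F b a n := by
  have hle : ∀ a b, chainLength F a b n ≤ chainLength F b a n := fun a b =>
    let ⟨_, hf⟩ := exists_isChainGenerator_chainLength b a n
    hf.reflect.chainLength_le
  exact le_antisymm (hle a b) (hle b a)

theorem add_chainLength_lt {a b n : ℕ} (hn : n < a) : n + chainLength F a b n < a + b := by
  have hle := (isChainGenerator_one (F := F) (a := a) (b := b) (n := n) (k := a + b - 1 - n)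
    (by omega)).chainLength_le
  omega

theorem le_add_chainLength {a b n : ℕ} (hn : n < a) : b ≤ n + chainLength F a b n :=
  let ⟨_, hf⟩ := exists_isChainGenerator_chainLength a b n
  hf.le_add hn

theorem chainLength_eq_zero {a b n : ℕ} (hb : b ≤ n) : chainLength F a b n = 0 := by
  have hone : IsChainGenerator a b n 0 (X ^ (n - b) : F[X]) := by
    refine ⟨by simp, by simp, fun i _ hd => ?_⟩
    rw [pow_zero, one_mul, coeff_X_pow, if_neg (by omega)]
  exact Nat.le_zero.1 hone.chainLength_le

theorem chainLength_pos {a b n : ℕ} (ha : n < a) (hb : n < b) : 0 < chainLength F a b n := by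
  have := le_add_chainLength (F := F) (b := b) ha
  omega

theorem add_chainLength_ne {a b n n' : ℕ} (hn' : n' < a) (hlt : n < n') :
    n + chainLength F a b n ≠ n' + chainLength F a b n' := by
  intro heq
  have hnb : n < b := by
    by_contra! hbn
    rw [chainLength_eq_zero hbn, chainLength_eq_zero (hbn.trans hlt.le)] at heq
    omega
  have hb := le_add_chainLength (F := F) (b := b) hn'
  have ha := chainLength_comm (F := F) a b n ▸ le_add_chainLength (F := F) (b := a) hnb
  obtain ⟨j, rfl⟩ := Nat.exists_eq_add_of_lt hlt
  obtain ⟨l, hl⟩ : ∃ l, chainLength F a b (n + j + 1) = l + 1 :=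
    Nat.exists_eq_succ_of_ne_zero (by omega)
  have hk : chainLength F a b n = l + (j + 1) + 1 := by omega
  obtain ⟨f, hf⟩ := exists_isChainGenerator_chainLength (F := F) a b n
  obtain ⟨g, hg⟩ := exists_isChainGenerator_chainLength (F := F) a b (n + j + 1)
  rw [hk] at hf
  rw [hl] at hg
  rcases hf.exists_pred j.succ_ne_zero (by omega) hg with ⟨u, hu⟩ | ⟨u, hu⟩
  · have := hu.chainLength_le
    omega
  · have : chainLength F a b (n + j + 1) ≤ l := hu.chainLength_le
    omega

variable (F) in
/-- The complement, in the socle degree `a + b - 2` of `F[x, y] / (x^a, y^b)`, of the degree in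
which the chain starting in degree `n` ends. Up to numbering from `0`, the map
`n ↦ dualDegree F a b n` is the Norman permutation. -/
noncomputable def dualDegree (a b n : ℕ) : ℕ :=
  a + b - 1 - (n + chainLength F a b n)

theorem add_chainLength_add_dualDegree {a b n : ℕ} (hn : n < a) :
    n + chainLength F a b n + dualDegree F a b n = a + b - 1 :=
  Nat.add_sub_cancel' (Nat.le_sub_one_of_lt (add_chainLength_lt hn))

theorem dualDegree_lt {a b n : ℕ} (hn : n < a) : dualDegree F a b n < a := by
  have := add_chainLength_add_dualDegree (F := F) (b := b) hn
  have := le_add_chainLength (F := F) (b := b) hn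
  omega

theorem dualDegree_comm (a b n : ℕ) : dualDegree F a b n = dualDegree F b a n := by
  rw [dualDegree, dualDegree, chainLength_comm, add_comm a b]

theorem dualDegree_ne {a b n n' : ℕ} (hn' : n' < a) (hlt : n < n') :
    dualDegree F a b n ≠ dualDegree F a b n' := by
  have := add_chainLength_ne (F := F) (b := b) hn' hlt
  have := add_chainLength_add_dualDegree (F := F) (b := b) hn'
  have := add_chainLength_add_dualDegree (F := F) (b := b) (hlt.trans hn')
  omega

theorem dualDegree_injective (a b : ℕ) :
    Function.Injective fun n : Fin a => (⟨dualDegree F a b n, dualDegree_lt n.2⟩ : Fin a) := by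
  intro n n' h
  have heq : dualDegree F a b n = dualDegree F a b n' := congrArg Fin.val h
  rcases lt_trichotomy n n' with hlt | hlt | hlt
  · exact absurd heq (dualDegree_ne n'.2 hlt)
  · exact hlt
  · exact absurd heq.symm (dualDegree_ne n.2 hlt)

variable (F) in
/-- The Norman permutation, as a permutation of `{0, ..., a - 1}`. -/
noncomputable def dualDegreePerm (a b : ℕ) : Equiv.Perm (Fin a) :=
  Equiv.ofBijective _ (Finite.injective_iff_bijective.1 (dualDegree_injective (F := F) a b))

theorem val_dualDegreePerm {a b : ℕ} (n : Fin a) :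
    (dualDegreePerm F a b n : ℕ) = dualDegree F a b n :=
  rfl

theorem sum_dualDegree (a b : ℕ) :
    ∑ n ∈ Finset.range a, dualDegree F a b n = ∑ n ∈ Finset.range a, n := by
  simp only [Finset.sum_range, ← val_dualDegreePerm]
  exact Equiv.sum_comp (dualDegreePerm F a b) Fin.val

theorem sum_chainLength (a b : ℕ) : ∑ n ∈ Finset.range a, chainLength F a b n = a * b := by
  rcases a with _ | a
  · simp
  have hsum : ∑ n ∈ Finset.range (a + 1),
      (n + chainLength F (a + 1) b n + dualDegree F (a + 1) b n) = (a + 1) * (a + b) := by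
    rw [Finset.sum_congr rfl fun n hn => add_chainLength_add_dualDegree (Finset.mem_range.1 hn),
      Finset.sum_const, Finset.card_range, smul_eq_mul, Nat.add_right_comm, Nat.add_sub_cancel]
  have hgauss := Finset.sum_range_id_mul_two (a + 1)
  rw [Finset.sum_add_distrib, Finset.sum_add_distrib, sum_dualDegree] at hsum
  rw [Nat.add_sub_cancel] at hgauss
  linarith

end ChainLength

section Reduction

open Polynomial

variable {F : Type*} [Field F] {r t Q : ℕ}

theorem IsChainGenerator.add {n k : ℕ} {f : F[X]} (hQ : (X : F[X]) ^ r ∣ (1 + X) ^ Q - 1)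
    (hf : IsChainGenerator r t n k f) : IsChainGenerator r (Q + t) n (Q + k) f := by
  refine ⟨hf.natDegree_le, hf.eval_ne_zero, fun i hi hd => ?_⟩
  rw [pow_add, mul_assoc, coeff_one_add_X_pow_mul_of_dvd hQ hi]
  exact hf.vanishes i hi (by omega)

theorem chainLength_add {n : ℕ} (hQ : (X : F[X]) ^ r ∣ (1 + X) ^ Q - 1) (hn : n < r) :
    chainLength F r (Q + t) n = Q + chainLength F r t n := by
  have hle : ∀ n ∈ Finset.range r, chainLength F r (Q + t) n ≤ Q + chainLength F r t n :=
    fun n _ =>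
      let ⟨_, hf⟩ := exists_isChainGenerator_chainLength r t n
      (hf.add hQ).chainLength_le
  refine (Finset.sum_eq_sum_iff_of_le hle).1 ?_ n (Finset.mem_range.2 hn)
  rw [Finset.sum_add_distrib, sum_chainLength, sum_chainLength, Finset.sum_const,
    Finset.card_range, smul_eq_mul, mul_add]

theorem dualDegree_add {n : ℕ} (hQ : (X : F[X]) ^ r ∣ (1 + X) ^ Q - 1) (hn : n < r) :
    dualDegree F r (Q + t) n = dualDegree F r t n := by
  rw [dualDegree, dualDegree, chainLength_add hQ hn]
  omega

theorem chainLength_sub_le (hQ : (X : F[X]) ^ r ∣ (1 + X) ^ Q - 1) (ht : t ≤ Q) (n : ℕ) :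
    chainLength F r (Q - t) n ≤ Q := by
  have hone : IsChainGenerator r (Q - t) n Q (1 : F[X]) := by
    refine ⟨by simp, by simp, fun i hi hd => ?_⟩
    rw [coeff_one_add_X_pow_mul_of_dvd hQ hi, coeff_one, if_neg (by omega)]
  exact hone.chainLength_le

theorem coeff_eq_zero_of_natDegree_one_add_X_mul_le {d : ℕ} {g : F[X]}
    (h : ((1 + X) * g).natDegree ≤ d) : g.coeff d = 0 := by
  rcases eq_or_ne g 0 with rfl | hg
  · exact coeff_zero d
  have hmonic : (1 + X : F[X]).Monic := by monicity!
  have hone : (1 + X : F[X]).natDegree = 1 := by compute_degree!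
  rw [hmonic.natDegree_mul' hg, hone] at h
  exact coeff_eq_zero_of_natDegree_lt (by omega)

/-- If the truncation were divisible by `1 + X`, the pivot coefficient of `(1 + X)^k f` would
vanish, and the chain would be shorter. -/
theorem IsChainGenerator.exists_truncation {a b n k d : ℕ} {f : F[X]}
    (hf : IsChainGenerator a b n (k + 1) f) (hmin : ¬ IsChainGenerator a b n k f)
    (hda : d < a) (hd : n + k + 1 = b + d) :
    ∃ h : F[X], h.natDegree ≤ d ∧ h.eval (-1) ≠ 0 ∧ X ^ a ∣ (1 + X) ^ (k + 1) * f - h := by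
  obtain ⟨h, hdeg, hcoeff⟩ := exists_natDegree_le_forall_coeff_eq ((1 + X) ^ (k + 1) * f) d
  have hdvd : X ^ a ∣ (1 + X) ^ (k + 1) * f - h := by
    refine X_pow_dvd_sub_iff.2 fun i hi => ?_
    rcases le_or_gt i d with hid | hid
    · exact (hcoeff i hid).symm
    · rw [hf.vanishes i hi (by omega), coeff_eq_zero_of_natDegree_lt (hdeg.trans_lt hid)]
  refine ⟨h, hdeg, fun heval => hmin ?_, hdvd⟩
  obtain ⟨g, rfl⟩ : 1 + X ∣ h := by
    have := dvd_iff_isRoot.2 heval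
    rwa [C_neg, C_1, sub_neg_eq_add, add_comm] at this
  have hdvd' : X ^ a ∣ (1 + X) ^ k * f - g :=
    X_pow_dvd_of_dvd_one_add_X_pow_mul (k := 1)
      (by rwa [pow_one, mul_sub, ← mul_assoc, ← pow_succ'])
  refine ⟨hf.natDegree_le, hf.eval_ne_zero, VanishesInDegree.of_one_add_X_mul (by omega) ?_ ?_⟩
  · rw [← mul_assoc, ← pow_succ']
    exact hf.vanishes
  · rw [show n + k + 1 - b = d by omega, X_pow_dvd_sub_iff.1 hdvd' d hda]
    exact coeff_eq_zero_of_natDegree_one_add_X_mul_le hdeg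

theorem chainLength_sub_dualDegree_le {n : ℕ} (hQ : (X : F[X]) ^ r ∣ (1 + X) ^ Q - 1)
    (hrt : r + t ≤ Q) (hn : n < r) :
    chainLength F r (Q - t) (r - 1 - dualDegree F r t n) ≤ Q - chainLength F r t n := by
  have hlt := add_chainLength_lt (F := F) (b := t) hn
  have hle := le_add_chainLength (F := F) (b := t) hn
  have hdual := add_chainLength_add_dualDegree (F := F) (b := t) hn
  obtain ⟨f, hf⟩ := exists_isChainGenerator_chainLength (F := F) r t n
  rcases hk : chainLength F r t n with _ | k
  · exact chainLength_sub_le hQ (by omega) _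
  have hmin : ¬ IsChainGenerator r t n k f := fun h => by
    have := h.chainLength_le
    omega
  rw [hk] at hf
  obtain ⟨h, hdeg, heval, hdvd⟩ := hf.exists_truncation (d := r - 1 - dualDegree F r t n) hmin
    (by omega) (by omega)
  refine (IsChainGenerator.mk hdeg heval fun i hi hd => ?_).chainLength_le
  have hdvd' : X ^ r ∣ (1 + X) ^ Q * f - (1 + X) ^ (Q - (k + 1)) * h := by
    have := hdvd.mul_left ((1 + X) ^ (Q - (k + 1)))
    rwa [mul_sub, ← mul_assoc, ← pow_add, Nat.sub_add_cancel (by omega)] at this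
  rw [← X_pow_dvd_sub_iff.1 hdvd' i hi, coeff_one_add_X_pow_mul_of_dvd hQ hi]
  exact coeff_eq_zero_of_natDegree_lt (hf.natDegree_le.trans_lt (by omega))

theorem le_of_monotone_of_forall_injective_le {ι α : Type*} [LinearOrder ι]
    [LocallyFiniteOrderBot ι] [Preorder α] {v w : ι → α} (hv : Monotone v) (hw : Monotone w)
    {e : ι → ι} (he : Function.Injective e) (h : ∀ i, v (e i) ≤ w i) (j : ι) : v j ≤ w j := by
  obtain ⟨i, hij, hji⟩ : ∃ i ≤ j, j ≤ e i := by
    by_contra! hlt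
    have hcard := Finset.card_le_card_of_injOn (s := Finset.Iic j) (t := Finset.Iio j) e
      (fun i hi => by simpa using hlt i (by simpa using hi)) he.injOn
    rw [← Finset.Iio_insert, Finset.card_insert_of_notMem Finset.notMem_Iio_self] at hcard
    omega
  exact (hv hji).trans ((h i).trans (hw hij))

theorem chainLength_sub {n : ℕ} (hQ : (X : F[X]) ^ r ∣ (1 + X) ^ Q - 1) (hrt : r + t ≤ Q)
    (hn : n < r) : chainLength F r (Q - t) (r - 1 - n) = Q - chainLength F r t n := by
  have hle : ∀ j ∈ Finset.range r,
      chainLength F r (Q - t) (r - 1 - j) ≤ Q - chainLength F r t j := fun j hj =>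
    le_of_monotone_of_forall_injective_le (ι := Fin r)
      (v := fun j => chainLength F r (Q - t) (r - 1 - j)) (w := fun j => Q - chainLength F r t j)
      (fun _ _ hij => chainLength_antitone r (Q - t) (Nat.sub_le_sub_left hij (r - 1)))
      (fun _ _ hij => Nat.sub_le_sub_left (chainLength_antitone r t hij) Q)
      (dualDegreePerm F r t).injective
      (fun j => chainLength_sub_dualDegree_le hQ hrt j.2) ⟨j, Finset.mem_range.1 hj⟩
  refine (Finset.sum_eq_sum_iff_of_le hle).1 ?_ n (Finset.mem_range.2 hn)
  have hcancel : ∀ j ∈ Finset.range r, chainLength F r t j ≤ Q := fun j hj => by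
    have := add_chainLength_lt (F := F) (b := t) (Finset.mem_range.1 hj)
    omega
  rw [Finset.sum_range_reflect, sum_chainLength, Finset.sum_tsub_distrib _ hcancel,
    sum_chainLength, Finset.sum_const, Finset.card_range, smul_eq_mul, Nat.mul_sub]

theorem dualDegree_sub {n : ℕ} (hQ : (X : F[X]) ^ r ∣ (1 + X) ^ Q - 1) (hrt : r + t ≤ Q)
    (hn : n < r) : dualDegree F r (Q - t) (r - 1 - n) = r - 1 - dualDegree F r t n := by
  have hlt := add_chainLength_lt (F := F) (b := t) hn
  have hle := le_add_chainLength (F := F) (b := t) hn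
  rw [dualDegree, dualDegree, chainLength_sub hQ hrt hn]
  omega

end Reduction

section Similarity

open Matrix

variable {F : Type*} [Field F] {ι κ ν : Type*} [Fintype ι] [Fintype κ] [Fintype ν]
  [DecidableEq ι] [DecidableEq κ] [DecidableEq ν]

theorem AreSimilar.symm {A : Matrix ι ι F} {B : Matrix κ κ F} (h : AreSimilar A B) :
    AreSimilar B A := by
  obtain ⟨P, Q, hPQ, hQP, rfl⟩ := h
  refine ⟨Q, P, hQP, hPQ, ?_⟩
  calc Q * (P * A * Q) * P = (Q * P) * A * (Q * P) := by simp only [Matrix.mul_assoc]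
    _ = A := by rw [hQP, Matrix.one_mul, Matrix.mul_one]

theorem AreSimilar.trans {A : Matrix ι ι F} {B : Matrix κ κ F} {C : Matrix ν ν F}
    (h : AreSimilar A B) (h' : AreSimilar B C) : AreSimilar A C := by
  obtain ⟨P, Q, hPQ, hQP, rfl⟩ := h
  obtain ⟨P', Q', hPQ', hQP', rfl⟩ := h'
  refine ⟨P' * P, Q * Q', ?_, ?_, by simp only [Matrix.mul_assoc]⟩
  · calc P' * P * (Q * Q') = P' * (P * Q) * Q' := by simp only [Matrix.mul_assoc]
      _ = 1 := by rw [hPQ, Matrix.mul_one, hPQ']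
  · calc Q * Q' * (P' * P) = Q * (Q' * P') * P := by simp only [Matrix.mul_assoc]
      _ = 1 := by rw [hQP', Matrix.mul_one, hQP]

theorem areSimilar_one_add_iff {A : Matrix ι ι F} {B : Matrix κ κ F} :
    AreSimilar (1 + A) (1 + B) ↔ AreSimilar A B := by
  refine exists_congr fun P => exists_congr fun Q => and_congr_right fun hPQ => ?_
  rw [Matrix.mul_add, Matrix.add_mul, Matrix.mul_one, hPQ, add_right_inj]

theorem AreSimilar.pow {A : Matrix ι ι F} {B : Matrix κ κ F} (h : AreSimilar A B) (k : ℕ) :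
    AreSimilar (A ^ k) (B ^ k) := by
  obtain ⟨P, Q, hPQ, hQP, rfl⟩ := h
  refine ⟨P, Q, hPQ, hQP, ?_⟩
  induction k with
  | zero => rw [pow_zero, pow_zero, Matrix.mul_one, hPQ]
  | succ k ih =>
    calc P * A ^ (k + 1) * Q = P * A ^ k * (Q * P) * (A * Q) := by
          rw [hQP, Matrix.mul_one, pow_succ]
          simp only [Matrix.mul_assoc]
      _ = (P * A ^ k * Q) * (P * A * Q) := by simp only [Matrix.mul_assoc]
      _ = (P * A * Q) ^ (k + 1) := by rw [ih, pow_succ]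

theorem AreSimilar.rank_le {A : Matrix ι ι F} {B : Matrix κ κ F} (h : AreSimilar A B) :
    B.rank ≤ A.rank := by
  obtain ⟨P, Q, -, -, rfl⟩ := h
  exact (rank_mul_le_left _ _).trans (rank_mul_le_right _ _)

theorem AreSimilar.rank_eq {A : Matrix ι ι F} {B : Matrix κ κ F} (h : AreSimilar A B) :
    A.rank = B.rank :=
  le_antisymm h.symm.rank_le h.rank_le

theorem AreSimilar.map {K : Type*} [Field K] {A : Matrix ι ι F} {B : Matrix κ κ F}
    (h : AreSimilar A B) (f : F →+* K) : AreSimilar (A.map f) (B.map f) := by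
  obtain ⟨P, Q, hPQ, hQP, rfl⟩ := h
  refine ⟨P.map f, Q.map f, ?_, ?_, ?_⟩
  · rw [← Matrix.map_mul, hPQ, Matrix.map_one f (map_zero f) (map_one f)]
  · rw [← Matrix.map_mul, hQP, Matrix.map_one f (map_zero f) (map_one f)]
  · rw [← Matrix.map_mul, ← Matrix.map_mul]

theorem AreSimilar.of_mul_eq_mul {A : Matrix ι ι F} {B : Matrix κ κ F} {P : Matrix κ ι F}
    (hcard : Fintype.card κ = Fintype.card ι) (hP : LinearIndependent F P.row)
    (h : P * A = B * P) : AreSimilar A B := by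
  have hsurj : Function.Surjective P.vecMulLinear :=
    (LinearMap.injective_iff_surjective_of_finrank_eq_finrank (by simpa using hcard)).1
      (vecMul_injective_iff.2 hP)
  obtain ⟨Q, hQP⟩ := vecMul_surjective_iff_exists_left_inverse.1 hsurj
  have hPQ : P * Q = 1 := (mul_eq_one_comm_of_equiv (Fintype.equivOfCardEq hcard.symm)).1 hQP
  exact ⟨P, Q, hPQ, hQP, by rw [h, Matrix.mul_assoc, hPQ, Matrix.mul_one]⟩

end Similarity

section JordanBlock

open Matrix
open scoped Kronecker

variable {F : Type*} [Field F]

theorem nilBlock_apply (r : ℕ) (i j : Fin r) :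
    nilBlock F r i j = if (i : ℕ) + 1 = j then 1 else 0 :=
  rfl

theorem nilBlock_pow_apply (r k : ℕ) (i j : Fin r) :
    (nilBlock F r ^ k) i j = if (i : ℕ) + k = j then 1 else 0 := by
  induction k generalizing i with
  | zero => simp only [pow_zero, one_apply, Fin.ext_iff, add_zero]
  | succ k ih =>
    simp only [pow_succ', mul_apply, ih, nilBlock_apply, ite_mul, one_mul, zero_mul]
    rcases lt_or_ge (i + 1 : ℕ) r with hi | hi
    · rw [Finset.sum_eq_single ⟨i + 1, hi⟩ (fun l _ hl => if_neg fun h => hl (Fin.ext h.symm))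
        (by simp), if_pos rfl, add_right_comm, add_assoc]
    · rw [Finset.sum_eq_zero fun l _ => if_neg (by omega), if_neg (by omega)]

theorem isUnit_jordanBlock (r : ℕ) : IsUnit (jordanBlock F r) := by
  refine IsNilpotent.isUnit_one_add ⟨r, ?_⟩
  ext i j
  rw [nilBlock_pow_apply, if_neg (by omega), Matrix.zero_apply]

theorem blockDiagonal_pow_mul_kronecker_nilBlock {ι : Type*} [Fintype ι] [DecidableEq ι]
    (A : Matrix ι ι F) (b : ℕ) :
    blockDiagonal (fun j : Fin b => A ^ (j : ℕ)) * (A ⊗ₖ nilBlock F b) =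
      (1 ⊗ₖ nilBlock F b) * blockDiagonal (fun j : Fin b => A ^ (j : ℕ)) := by
  ext ⟨i, j⟩ ⟨i', j'⟩
  simp only [mul_apply, Fintype.sum_prod_type, kroneckerMap_apply, blockDiagonal_apply,
    one_apply, ite_mul, mul_ite, zero_mul, mul_zero, one_mul, Finset.sum_ite_eq,
    Finset.sum_ite_eq', Finset.mem_univ, if_true, ← mul_assoc]
  rw [← Finset.sum_mul, ← mul_apply, ← pow_succ, nilBlock_apply]
  split_ifs with h
  · rw [h, mul_one, one_mul]
  · rw [mul_zero, zero_mul]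

/-- The change of variables `y ↦ A y`, which multiplies `y^j` by `A^j`. -/
theorem areSimilar_kronecker_jordanBlock {ι : Type*} [Fintype ι] [DecidableEq ι]
    {A : Matrix ι ι F} (hA : IsUnit A) (b : ℕ) :
    AreSimilar (A ⊗ₖ jordanBlock F b) (A ⊗ₖ 1 + 1 ⊗ₖ nilBlock F b) := by
  obtain ⟨u, rfl⟩ := hA
  set P := blockDiagonal fun j : Fin b => (u : Matrix ι ι F) ^ (j : ℕ) with hP
  set Q := blockDiagonal fun j : Fin b => ((u ^ (j : ℕ))⁻¹ : (Matrix ι ι F)ˣ).val with hQ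
  have hPQ : P * Q = 1 := by
    simp only [hP, hQ, ← blockDiagonal_mul, ← Units.val_pow_eq_pow_val, Units.mul_inv]
    exact blockDiagonal_one
  have hcomm : P * (u.val ⊗ₖ 1) = (u.val ⊗ₖ 1) * P := by
    simp only [hP, kronecker_one, ← blockDiagonal_mul, ← pow_succ, ← pow_succ']
  refine ⟨P, Q, hPQ, mul_eq_one_comm.1 hPQ, ?_⟩
  rw [jordanBlock, kronecker_add, Matrix.mul_add, hcomm,
    blockDiagonal_pow_mul_kronecker_nilBlock, ← Matrix.add_mul, Matrix.mul_assoc, hPQ,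
    Matrix.mul_one]

variable (F) in
theorem areSimilar_kronecker_jordanBlock_jordanBlock (a b : ℕ) :
    AreSimilar (jordanBlock F a ⊗ₖ jordanBlock F b)
      (1 + (nilBlock F a ⊗ₖ 1 + 1 ⊗ₖ nilBlock F b)) := by
  have hone : jordanBlock F a ⊗ₖ (1 : Matrix (Fin b) (Fin b) F) = 1 + nilBlock F a ⊗ₖ 1 := by
    rw [jordanBlock, add_kronecker, one_kronecker_one]
  rw [← add_assoc, ← hone]
  exact areSimilar_kronecker_jordanBlock (isUnit_jordanBlock a) b

theorem blockDiagonal'_jordanBlock {ι : Type*} [DecidableEq ι] (lam : ι → ℕ) :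
    blockDiagonal' (fun i => jordanBlock F (lam i)) =
      1 + blockDiagonal' (fun i => nilBlock F (lam i)) := by
  rw [← blockDiagonal'_one, ← blockDiagonal'_add]
  rfl

theorem nilBlock_pow_mul_transpose (r k : ℕ) :
    nilBlock F r ^ k * (nilBlock F r ^ k)ᵀ =
      diagonal fun j : Fin r => if (j : ℕ) + k < r then 1 else 0 := by
  ext j l
  simp only [mul_apply, transpose_apply, nilBlock_pow_apply, diagonal_apply, ite_mul, one_mul,
    zero_mul]
  rcases lt_or_ge (j + k : ℕ) r with hj | hj
  · rw [Finset.sum_eq_single ⟨j + k, hj⟩ (fun x _ hx => if_neg fun h => hx (Fin.ext h.symm))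
      (by simp)]
    simp [hj, Fin.ext_iff, eq_comm]
  · rw [Finset.sum_eq_zero fun x _ => if_neg (by omega), if_neg hj.not_gt, ite_self]

theorem diagonal_mul_nilBlock_pow (r k : ℕ) :
    diagonal (fun j : Fin r => if (j : ℕ) + k < r then 1 else 0) * nilBlock F r ^ k =
      nilBlock F r ^ k := by
  ext j l
  rw [diagonal_mul, nilBlock_pow_apply]
  split_ifs with hj hl hl
  · exact one_mul 1
  · exact one_mul 0
  · omega
  · exact zero_mul 0

theorem sum_fin_ite_add_lt (l k : ℕ) : ∑ j : Fin l, (if (j : ℕ) + k < l then 1 else 0) = l - k := by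
  rw [Fin.sum_univ_eq_sum_range (fun j => if j + k < l then 1 else 0), ← Finset.card_filter]
  have hfilter : {j ∈ Finset.range l | j + k < l} = Finset.range (l - k) := by
    ext j
    simp only [Finset.mem_filter, Finset.mem_range]
    omega
  rw [hfilter, Finset.card_range]

theorem rank_blockDiagonal'_nilBlock_pow {ι : Type*} [Fintype ι] [DecidableEq ι]
    (lam : ι → ℕ) (k : ℕ) :
    (blockDiagonal' (fun i => nilBlock F (lam i)) ^ k).rank = ∑ i, (lam i - k) := by
  classical
  set N := blockDiagonal' fun i => nilBlock F (lam i) ^ k with hN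
  set D : Matrix (Σ i, Fin (lam i)) (Σ i, Fin (lam i)) F :=
    blockDiagonal' fun i => diagonal fun j => if (j : ℕ) + k < lam i then 1 else 0 with hD
  have hNNT : N * Nᵀ = D := by
    simp only [hN, hD, blockDiagonal'_transpose, ← blockDiagonal'_mul, nilBlock_pow_mul_transpose]
  have hDN : D * N = N := by
    simp only [hN, hD, ← blockDiagonal'_mul, diagonal_mul_nilBlock_pow]
  have hrank : N.rank = D.rank :=
    le_antisymm (by simpa only [hDN] using rank_mul_le_left D N) (hNNT ▸ rank_mul_le_left N Nᵀ)
  have hpow : blockDiagonal' (fun i => nilBlock F (lam i)) ^ k = N :=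
    (blockDiagonal'_pow _ k).symm
  rw [hpow, hrank, hD, blockDiagonal'_diagonal, rank_diagonal, Fintype.card_subtype,
    Finset.card_filter, Fintype.sum_sigma]
  simp only [ne_eq, ite_eq_right_iff, one_ne_zero, imp_false, not_not, sum_fin_ite_add_lt]

theorem le_of_sum_tsub_le {ι : Type*} [Fintype ι] [LinearOrder ι] {lam mu : ι → ℕ}
    (hmu : Antitone mu) {i : ι} (heq : ∀ j < i, lam j = mu j)
    (hsum : ∑ j, (lam j - mu i) ≤ ∑ j, (mu j - mu i)) : lam i ≤ mu i := by
  by_contra! hlt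
  refine hsum.not_gt (Finset.sum_lt_sum (fun j _ => ?_) ⟨i, Finset.mem_univ i, by omega⟩)
  rcases lt_or_ge j i with hj | hj
  · rw [heq j hj]
  · have := hmu hj
    omega

theorem eq_of_forall_sum_tsub_eq {ι : Type*} [Fintype ι] [LinearOrder ι] {lam mu : ι → ℕ}
    (hlam : Antitone lam) (hmu : Antitone mu)
    (hsum : ∀ k, ∑ i, (lam i - k) = ∑ i, (mu i - k)) : lam = mu := by
  funext i
  induction i using WellFoundedLT.induction with
  | ind i ih =>
    exact le_antisymm (le_of_sum_tsub_le hmu ih (hsum _).le)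
      (le_of_sum_tsub_le hlam (fun j hj => (ih j hj).symm) (hsum _).ge)

theorem IsJordanPartition.unique {a b : ℕ} {lam mu : Fin a → ℕ}
    (hlam : IsJordanPartition F a b lam) (hmu : IsJordanPartition F a b mu) : lam = mu := by
  have hsim := hlam.2.2.symm.trans hmu.2.2
  rw [blockDiagonal'_jordanBlock, blockDiagonal'_jordanBlock, areSimilar_one_add_iff] at hsim
  refine eq_of_forall_sum_tsub_eq hlam.1 hmu.1 fun k => ?_
  simpa only [rank_blockDiagonal'_nilBlock_pow] using (hsim.pow k).rank_eq

theorem jordanBlock_map {K : Type*} [Field K] (f : F →+* K) (r : ℕ) :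
    (jordanBlock F r).map f = jordanBlock K r := by
  ext i j
  simp [jordanBlock, nilBlock, Matrix.one_apply, apply_ite f]

theorem IsJordanPartition.map {K : Type*} [Field K] (f : F →+* K) {a b : ℕ} {lam : Fin a → ℕ}
    (h : IsJordanPartition F a b lam) : IsJordanPartition K a b lam := by
  refine ⟨h.1, h.2.1, ?_⟩
  have hkron : (kronecker (jordanBlock F a) (jordanBlock F b)).map f =
      kronecker (jordanBlock K a) (jordanBlock K b) := by
    rw [← jordanBlock_map f a, ← jordanBlock_map f b]
    ext
    exact map_mul f _ _
  have hsim := h.2.2.map f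
  rw [hkron, blockDiagonal'_map _ _ (map_zero f)] at hsim
  simpa only [jordanBlock_map] using hsim

end JordanBlock

section JordanBasis

open Matrix Polynomial
open scoped Kronecker

variable {F : Type*} [Field F] {a b : ℕ}

/-- The coordinates, with respect to the monomials `x^i y^j` of `F[x, y] / (x^a, y^b)`, of the
form of degree `d` which is encoded by `f`. -/
noncomputable def formVec (a b d : ℕ) : F[X] →ₗ[F] (Fin a × Fin b → F) :=
  LinearMap.pi fun x => if (x.1 : ℕ) + x.2 = d then lcoeff F x.1 else 0

theorem formVec_apply (d : ℕ) (f : F[X]) (x : Fin a × Fin b) :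
    formVec a b d f x = if (x.1 : ℕ) + x.2 = d then f.coeff x.1 else 0 := by
  rw [formVec, LinearMap.pi_apply]
  split_ifs <;> rfl

theorem formVec_eq_zero_iff {d : ℕ} {f : F[X]} (hf : f.natDegree ≤ d) :
    formVec a b d f = 0 ↔ VanishesInDegree a b d f := by
  refine ⟨fun h i hi hd => ?_, fun h => funext fun x => ?_⟩
  · rcases le_or_gt i d with hid | hid
    · have hx := congrFun h (⟨i, hi⟩, ⟨d - i, by omega⟩)
      rwa [formVec_apply, if_pos (Nat.add_sub_cancel' hid)] at hx
    · exact coeff_eq_zero_of_natDegree_lt (hf.trans_lt hid)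
  · rw [formVec_apply, Pi.zero_apply, ite_eq_right_iff]
    exact fun hd => h x.1 x.1.2 (by omega)

theorem formVec_sum_filter_eq_zero {ι : Type*} {s : Finset ι} {deg : ι → ℕ} {g : ι → F[X]}
    (h : ∑ x ∈ s, formVec a b (deg x) (g x) = 0) (d : ℕ) :
    formVec a b d (∑ x ∈ s with deg x = d, g x) = 0 := by
  funext y
  have hy := congrFun h y
  simp only [Finset.sum_apply, formVec_apply, Pi.zero_apply] at hy
  rw [map_sum, Finset.sum_apply, Pi.zero_apply]
  by_cases hd : (y.1 : ℕ) + y.2 = d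
  · simpa only [formVec_apply, Finset.sum_filter, hd, if_true, eq_comm (a := d)] using hy
  · exact Finset.sum_eq_zero fun x _ => by rw [formVec_apply, if_neg hd]

theorem sum_mul_nilBlock {r : ℕ} (v : ℕ → F) (j : Fin r) :
    ∑ i : Fin r, v i * nilBlock F r i j = if (j : ℕ) = 0 then 0 else v (j - 1) := by
  simp only [nilBlock_apply, mul_ite, mul_one, mul_zero]
  split_ifs with hj
  · exact Finset.sum_eq_zero fun i _ => if_neg (by omega)
  · rw [Finset.sum_eq_single ⟨j - 1, by omega⟩
      (fun i _ hi => if_neg fun h => hi (Fin.ext (Nat.eq_sub_of_add_eq h))) (by simp),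
      if_pos (Nat.sub_add_cancel (Nat.pos_of_ne_zero hj))]

theorem vecMul_nilBlock_kronecker_one (v : ℕ → ℕ → F) :
    (fun x : Fin a × Fin b => v x.1 x.2) ᵥ* (nilBlock F a ⊗ₖ (1 : Matrix (Fin b) (Fin b) F)) =
      fun x : Fin a × Fin b => if (x.1 : ℕ) = 0 then 0 else v (x.1 - 1) x.2 := by
  funext x
  rw [← sum_mul_nilBlock fun i => v i x.2]
  simp [vecMul, dotProduct, Fintype.sum_prod_type, one_apply]

theorem vecMul_one_kronecker_nilBlock (v : ℕ → ℕ → F) :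
    (fun x : Fin a × Fin b => v x.1 x.2) ᵥ*
        ((1 : Matrix (Fin a) (Fin a) F) ⊗ₖ nilBlock F b) =
      fun x : Fin a × Fin b => if (x.2 : ℕ) = 0 then 0 else v x.1 (x.2 - 1) := by
  funext x
  rw [← sum_mul_nilBlock (v x.1)]
  simp [vecMul, dotProduct, Fintype.sum_prod_type_right, one_apply]

theorem formVec_vecMul {d : ℕ} {f : F[X]} (hf : f.natDegree ≤ d) :
    formVec a b d f ᵥ* (nilBlock F a ⊗ₖ 1 + 1 ⊗ₖ nilBlock F b) =
      formVec a b (d + 1) ((1 + X) * f) := by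
  set v : ℕ → ℕ → F := fun i j => if i + j = d then f.coeff i else 0 with hv
  have hvec : formVec a b d f = fun x => v x.1 x.2 := funext fun x => formVec_apply d f x
  have htop : f.coeff (d + 1) = 0 := coeff_eq_zero_of_natDegree_lt (by omega)
  rw [hvec, vecMul_add, vecMul_nilBlock_kronecker_one v, vecMul_one_kronecker_nilBlock v, hv]
  funext ⟨⟨i, hi⟩, ⟨j, hj⟩⟩
  rw [Pi.add_apply, formVec_apply]
  rcases i with _ | i <;> rcases j with _ | j
  · simp
  · simp [add_mul]
  · simp only [Nat.add_one_ne_zero, if_false, if_true, Nat.add_sub_cancel, add_zero,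
      Nat.add_right_cancel_iff, coeff_one_add_X_mul_succ]
    split_ifs with hd
    · rw [hd, htop, zero_add]
    · rfl
  · simp only [Nat.add_one_ne_zero, if_false, Nat.add_sub_cancel, ← add_assoc,
      add_right_comm i 1 j, Nat.add_right_cancel_iff, coeff_one_add_X_mul_succ]
    split_ifs with hd
    · exact add_comm _ _
    · exact add_zero 0

/-- After cancelling a power of `1 + X`, only the form of largest degree contributes to the value
at `-1`. -/
theorem exists_isChainGenerator_of_vanishesInDegree_sum {ι : Type*} {s : Finset ι}
    {n k : ι → ℕ} {f : ι → F[X]} {d : ℕ} (hdeg : ∀ y ∈ s, n y + k y = d)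
    (hf : ∀ y ∈ s, (f y).natDegree ≤ n y)
    (hvan : VanishesInDegree a b d (∑ y ∈ s, (1 + X) ^ k y * f y)) {x : ι} (hx : x ∈ s)
    (hmax : ∀ y ∈ s, y ≠ x → n y < n x) (heval : (f x).eval (-1) ≠ 0) :
    ∃ g : F[X], IsChainGenerator a b (n x) (k x) g := by
  have hk : ∀ y ∈ s, k x ≤ k y ∧ n y + (k y - k x) = n x ∧ (y ≠ x → k y - k x ≠ 0) :=
    fun y hy => by
      have hdx := hdeg x hx
      have hdy := hdeg y hy
      rcases eq_or_ne y x with rfl | hyx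
      · simp
      · have := hmax y hy hyx
        exact ⟨by omega, by omega, fun _ => by omega⟩
  refine ⟨∑ y ∈ s, (1 + X) ^ (k y - k x) * f y, ?_, ?_, ?_⟩
  · exact natDegree_sum_le_of_forall_le s _ fun y hy =>
      (natDegree_one_add_X_pow_mul_le (hf y hy)).trans_eq (hk y hy).2.1
  · rw [eval_finsetSum, Finset.sum_eq_single_of_mem x hx fun y hy hyx => ?_]
    · simpa using heval
    · simp [(hk y hy).2.2 hyx]
  · rw [hdeg x hx, Finset.mul_sum]
    have hsum : ∑ y ∈ s, (1 + X) ^ k x * ((1 + X) ^ (k y - k x) * f y) =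
        ∑ y ∈ s, (1 + X) ^ k y * f y :=
      Finset.sum_congr rfl fun y hy => by
        rw [← mul_assoc, ← pow_add, Nat.add_sub_cancel' (hk y hy).1]
    rwa [hsum]

variable (F a b) in
/-- A form which starts a Jordan chain of `x + y` of length `chainLength F a b n`. -/
noncomputable def chainGenerator (n : ℕ) : F[X] :=
  (exists_isChainGenerator_chainLength a b n).choose

theorem isChainGenerator_chainGenerator (n : ℕ) :
    IsChainGenerator a b n (chainLength F a b n) (chainGenerator F a b n) :=
  (exists_isChainGenerator_chainLength a b n).choose_spec

theorem natDegree_one_add_X_pow_mul_chainGenerator_le (n k : ℕ) :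
    ((1 + X) ^ k * chainGenerator F a b n).natDegree ≤ n + k :=
  natDegree_one_add_X_pow_mul_le (isChainGenerator_chainGenerator n).natDegree_le

variable (F a b) in
/-- The matrix whose row `⟨n, k⟩` is the `k`-th vector of the Jordan chain which starts in
degree `n`. -/
noncomputable def chainMatrix :
    Matrix (Σ n : Fin a, Fin (chainLength F a b n)) (Fin a × Fin b) F :=
  Matrix.of fun x => formVec a b (x.1 + x.2) ((1 + X) ^ (x.2 : ℕ) * chainGenerator F a b x.1)

theorem linearIndependent_row_chainMatrix : LinearIndependent F (chainMatrix F a b).row := by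
  classical
  rw [Fintype.linearIndependent_iff]
  intro c hc
  by_contra! hne
  obtain ⟨x₀, hx₀⟩ := hne
  set d : ℕ := x₀.1 + x₀.2
  set f := fun x : Σ n : Fin a, Fin (chainLength F a b n) => c x • chainGenerator F a b x.1
  set s := {x ∈ Finset.univ.filter (c · ≠ 0) | (x.1 : ℕ) + x.2 = d} with hs
  have hsum : ∑ x with c x ≠ 0, formVec a b (x.1 + x.2) ((1 + X) ^ (x.2 : ℕ) * f x) = 0 := by
    rw [← hc, Finset.sum_filter_of_ne]
    · refine Finset.sum_congr rfl fun x _ => ?_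
      rw [mul_smul_comm, map_smul]
      rfl
    · rintro x - hx hcx
      exact hx (by simp only [f, hcx, zero_smul, mul_zero, map_zero])
  have hmem : ∀ {x}, x ∈ s ↔ c x ≠ 0 ∧ (x.1 : ℕ) + x.2 = d := by simp [hs]
  have hdeg : ∀ x, (f x).natDegree ≤ x.1 := fun x =>
    (natDegree_smul_le _ _).trans (isChainGenerator_chainGenerator _).natDegree_le
  have hvan : VanishesInDegree a b d (∑ x ∈ s, (1 + X) ^ (x.2 : ℕ) * f x) := by
    refine (formVec_eq_zero_iff (natDegree_sum_le_of_forall_le s _ fun x hx => ?_)).1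
      (formVec_sum_filter_eq_zero hsum d)
    exact (natDegree_one_add_X_pow_mul_le (hdeg x)).trans_eq (hmem.1 hx).2
  obtain ⟨x, hx, hmax⟩ := s.exists_max_image (fun x => (x.1 : ℕ)) ⟨x₀, hmem.2 ⟨hx₀, rfl⟩⟩
  have hlt : ∀ y ∈ s, y ≠ x → (y.1 : ℕ) < x.1 := fun y hy hyx =>
    (hmax y hy).lt_of_ne fun h => by
      have := (hmem.1 hy).2.trans (hmem.1 hx).2.symm
      exact hyx (Sigma.ext (Fin.ext h) ((Fin.heq_ext_iff (by rw [h])).2 (by omega)))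
  have heval : (f x).eval (-1) ≠ 0 := by
    simpa [f, (hmem.1 hx).1] using (isChainGenerator_chainGenerator (F := F) _).eval_ne_zero
  obtain ⟨g, hg⟩ := exists_isChainGenerator_of_vanishesInDegree_sum
    (n := fun x => (x.1 : ℕ)) (fun y hy => (hmem.1 hy).2) (fun y _ => hdeg y) hvan hx hlt heval
  exact hg.chainLength_le.not_gt x.2.2

theorem blockDiagonal'_nilBlock_mul_apply {ι κ : Type*} [Fintype ι] [DecidableEq ι]
    {lam : ι → ℕ} (P : Matrix (Σ i, Fin (lam i)) κ F) (i : ι) (k : Fin (lam i)) :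
    (blockDiagonal' (fun i => nilBlock F (lam i)) * P) ⟨i, k⟩ =
      if h : (k : ℕ) + 1 < lam i then P ⟨i, k + 1, h⟩ else 0 := by
  funext y
  rw [mul_apply, Fintype.sum_sigma, Finset.sum_eq_single_of_mem i (Finset.mem_univ i)
    fun j _ hj => Finset.sum_eq_zero fun l _ => by
      rw [blockDiagonal'_apply_ne _ _ _ hj.symm, zero_mul]]
  simp only [blockDiagonal'_apply_eq, nilBlock_apply, ite_mul, one_mul, zero_mul]
  split_ifs with h
  · rw [Finset.sum_eq_single ⟨k + 1, h⟩ (fun l _ hl => if_neg fun h' => hl (Fin.ext h'.symm))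
      (by simp), if_pos rfl]
  · exact Finset.sum_eq_zero fun l _ => if_neg (by omega)

theorem chainMatrix_mul : chainMatrix F a b * (nilBlock F a ⊗ₖ 1 + 1 ⊗ₖ nilBlock F b) =
    blockDiagonal' (fun n : Fin a => nilBlock F (chainLength F a b n)) * chainMatrix F a b := by
  funext ⟨n, k⟩
  rw [mul_apply_eq_vecMul, blockDiagonal'_nilBlock_mul_apply]
  have hrow : chainMatrix F a b ⟨n, k⟩ ᵥ* (nilBlock F a ⊗ₖ 1 + 1 ⊗ₖ nilBlock F b) =
      formVec a b (n + k + 1) ((1 + X) ^ (k + 1 : ℕ) * chainGenerator F a b n) := by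
    rw [pow_succ', mul_assoc]
    exact formVec_vecMul (natDegree_one_add_X_pow_mul_chainGenerator_le n k)
  rw [hrow]
  split_ifs with hk
  · rfl
  · have hlast : (k : ℕ) + 1 = chainLength F a b n := by omega
    rw [add_assoc, formVec_eq_zero_iff (natDegree_one_add_X_pow_mul_chainGenerator_le _ _), hlast]
    exact (isChainGenerator_chainGenerator n).vanishes

variable (F a b) in
theorem areSimilar_blockDiagonal'_chainLength :
    AreSimilar (nilBlock F a ⊗ₖ 1 + 1 ⊗ₖ nilBlock F b)
      (blockDiagonal' fun n : Fin a => nilBlock F (chainLength F a b n)) := by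
  refine .of_mul_eq_mul ?_ linearIndependent_row_chainMatrix chainMatrix_mul
  simp only [Fintype.card_sigma, Fintype.card_prod, Fintype.card_fin, ← sum_chainLength (F := F),
    Finset.sum_range]

variable (F) in
theorem isJordanPartition_chainLength (hab : a ≤ b) :
    IsJordanPartition F a b fun n => chainLength F a b n := by
  refine ⟨fun i j hij => chainLength_antitone a b hij,
    fun i => chainLength_pos i.2 (i.2.trans_le hab), ?_⟩
  rw [blockDiagonal'_jordanBlock]
  exact (areSimilar_kronecker_jordanBlock_jordanBlock F a b).trans
    (areSimilar_one_add_iff.2 (areSimilar_blockDiagonal'_chainLength F a b))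

end JordanBasis

section NormanPerm

open Polynomial

variable {F : Type*} [Field F] {a b r t Q : ℕ}

theorem Rev_apply (i j n : ℕ) : Rev i j n = if i ≤ n ∧ n ≤ j then i + j - n else n :=
  rfl

theorem Rev_symm (i j : ℕ) : (Rev i j).symm = Rev i j :=
  (revFun_involutive i j).toPerm_symm

theorem Rev_trans_Rev (ht : t ≤ r) :
    (Rev 1 r).trans (Rev (t + 1) r) = (Rev 1 (r - t)).trans (Rev 1 r) := by
  ext n
  simp only [Equiv.trans_apply, Rev_apply]
  grind

theorem perm_ext_of_fixes {σ τ : Equiv.Perm ℕ} (hσ : ∀ n ∉ Finset.Icc 1 r, σ n = n)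
    (hτ : ∀ n ∉ Finset.Icc 1 r, τ n = n) (h : ∀ n < r, σ (n + 1) = τ (n + 1)) : σ = τ := by
  ext n
  by_cases hn : n ∈ Finset.Icc 1 r
  · rw [Finset.mem_Icc] at hn
    obtain ⟨n, rfl⟩ := Nat.exists_eq_succ_of_ne_zero (Nat.one_le_iff_ne_zero.1 hn.1)
    exact h n hn.2
  · rw [hσ n hn, hτ n hn]

variable (F) in
/-- The permutation `dualDegreePerm`, renumbered from `1` and extended by the identity to `ℕ`. -/
noncomputable def chainPerm (a b : ℕ) : Equiv.Perm ℕ :=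
  (dualDegreePerm F a b).viaFintypeEmbedding (Fin.valEmbedding.trans (addRightEmbedding 1))

theorem chainPerm_succ {n : ℕ} (hn : n < a) : chainPerm F a b (n + 1) = dualDegree F a b n + 1 :=
  (dualDegreePerm F a b).viaFintypeEmbedding_apply_image
    (Fin.valEmbedding.trans (addRightEmbedding 1)) ⟨n, hn⟩

theorem chainPerm_apply_of_notMem {n : ℕ} (hn : n ∉ Finset.Icc 1 a) : chainPerm F a b n = n := by
  refine (dualDegreePerm F a b).viaFintypeEmbedding_apply_notMem_range _ ?_
  rintro ⟨i, rfl⟩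
  exact hn (Finset.mem_Icc.2 ⟨Nat.le_add_left 1 i, i.2⟩)

theorem isNormanPerm_chainPerm (hab : a ≤ b) : IsNormanPerm F a b (chainPerm F a b) := by
  refine ⟨_, isJordanPartition_chainLength F hab, fun i => ?_,
    fun n hn => chainPerm_apply_of_notMem hn⟩
  rw [chainPerm_succ i.2]
  have := add_chainLength_add_dualDegree (F := F) (b := b) i.2
  omega

theorem IsNormanPerm.unique {σ τ : Equiv.Perm ℕ} (hσ : IsNormanPerm F a b σ)
    (hτ : IsNormanPerm F a b τ) : σ = τ := by
  obtain ⟨lam, hlam, hσ, hσfix⟩ := hσ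
  obtain ⟨mu, hmu, hτ, hτfix⟩ := hτ
  obtain rfl := hlam.unique hmu
  refine perm_ext_of_fixes hσfix hτfix fun n hn => ?_
  exact_mod_cast (hσ ⟨n, hn⟩).trans (hτ ⟨n, hn⟩).symm

theorem IsNormanPerm.map {K : Type*} [Field K] (f : F →+* K) {σ : Equiv.Perm ℕ}
    (h : IsNormanPerm F a b σ) : IsNormanPerm K a b σ :=
  let ⟨lam, hlam, hσ⟩ := h
  ⟨lam, hlam.map f, hσ⟩

theorem isNormanPerm_normanPerm (p : ℕ) [Fact p.Prime] [CharP F p] (hab : a ≤ b) :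
    IsNormanPerm F a b (normanPerm p a b) := by
  have h : IsNormanPerm (ZMod p) a b (normanPerm p a b) :=
    Classical.epsilon_spec ⟨_, isNormanPerm_chainPerm hab⟩
  exact h.map (ZMod.castHom dvd_rfl F)

theorem isNormanPerm_iff_eq_normanPerm (p : ℕ) [Fact p.Prime] [CharP F p] (hab : a ≤ b)
    (σ : Equiv.Perm ℕ) : IsNormanPerm F a b σ ↔ σ = normanPerm p a b :=
  ⟨fun h => h.unique (isNormanPerm_normanPerm p hab),
    fun h => h ▸ isNormanPerm_normanPerm p hab⟩

variable (F) in
theorem normanPerm_eq_chainPerm (p : ℕ) [Fact p.Prime] [CharP F p] (hab : a ≤ b) :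
    normanPerm p a b = chainPerm F a b :=
  (isNormanPerm_normanPerm p hab).unique (isNormanPerm_chainPerm hab)

theorem chainPerm_eq_trans_Rev (ht : t ≤ r) :
    chainPerm F r t = (chainPerm F t r).trans (Rev (t + 1) r) := by
  refine perm_ext_of_fixes (r := r) (fun n hn => chainPerm_apply_of_notMem hn) (fun n hn => ?_)
    fun n hn => ?_
  · rw [Finset.mem_Icc] at hn
    rw [Equiv.trans_apply, chainPerm_apply_of_notMem (by rw [Finset.mem_Icc]; omega), Rev_apply,
      if_neg (by omega)]
  · rw [chainPerm_succ hn, Equiv.trans_apply]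
    rcases lt_or_ge n t with hnt | hnt
    · have hlt := dualDegree_lt (F := F) (b := r) hnt
      rw [chainPerm_succ hnt, Rev_apply, if_neg (by omega), dualDegree_comm]
    · rw [chainPerm_apply_of_notMem (by rw [Finset.mem_Icc]; omega), Rev_apply,
        if_pos (by omega), dualDegree, chainLength_eq_zero hnt]
      omega

theorem chainPerm_trans_Rev_comm (r t b : ℕ) :
    (chainPerm F t b).trans (Rev (t + 1) r) = (Rev (t + 1) r).trans (chainPerm F t b) := by
  have hdisj : (Rev (t + 1) r).Disjoint (chainPerm F t b) := fun n => by
    by_cases hn : n ∈ Finset.Icc 1 t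
    · rw [Finset.mem_Icc] at hn
      exact .inl (if_neg (by omega))
    · exact .inr (chainPerm_apply_of_notMem hn)
  exact hdisj.commute.eq

theorem chainPerm_add (hQ : (X : F[X]) ^ r ∣ (1 + X) ^ Q - 1) :
    chainPerm F r (Q + t) = chainPerm F r t := by
  refine perm_ext_of_fixes (r := r) (fun n hn => chainPerm_apply_of_notMem hn)
    (fun n hn => chainPerm_apply_of_notMem hn) fun n hn => ?_
  rw [chainPerm_succ hn, chainPerm_succ hn, dualDegree_add hQ hn]

theorem chainPerm_sub (hQ : (X : F[X]) ^ r ∣ (1 + X) ^ Q - 1) (hrt : r + t ≤ Q) :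
    chainPerm F r (Q - t) = (Rev 1 r).trans ((chainPerm F r t).trans (Rev 1 r)) := by
  refine perm_ext_of_fixes (r := r) (fun n hn => chainPerm_apply_of_notMem hn) (fun n hn => ?_)
    fun n hn => ?_
  · have hRev : Rev 1 r n = n := if_neg (by rwa [Finset.mem_Icc] at hn)
    simp only [Equiv.trans_apply, hRev, chainPerm_apply_of_notMem hn]
  · obtain ⟨j, hj, rfl⟩ : ∃ j < r, n = r - 1 - j := ⟨r - 1 - n, by omega, by omega⟩
    have hlt := dualDegree_lt (F := F) (b := t) hj
    have hRev : Rev 1 r (r - 1 - j + 1) = j + 1 := by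
      rw [Rev_apply, if_pos (by omega)]
      omega
    rw [chainPerm_succ hn, dualDegree_sub hQ hrt hj, Equiv.trans_apply, hRev, Equiv.trans_apply,
      chainPerm_succ hj, Rev_apply, if_pos (by omega)]
    omega

theorem normanPerm_mul_pow_add (p : ℕ) [Fact p.Prime] {m N : ℕ} (hN : 1 ≤ N) (ht : t ≤ r)
    (hr : r ≤ p ^ m) :
    normanPerm p r (N * p ^ m + t) = (normanPerm p t r).trans (Rev (t + 1) r) := by
  have hle : p ^ m ≤ N * p ^ m := Nat.le_mul_of_pos_left _ hN
  rw [normanPerm_eq_chainPerm (ZMod p) p (by omega), normanPerm_eq_chainPerm (ZMod p) p ht,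
    chainPerm_add (X_pow_dvd_one_add_X_pow_sub_one p hr N), chainPerm_eq_trans_Rev ht]

theorem normanPerm_mul_pow_sub (p : ℕ) [Fact p.Prime] {m N : ℕ} (hN : 2 ≤ N) (ht : t ≤ r)
    (hr : r ≤ p ^ m) :
    normanPerm p r (N * p ^ m - t) =
      (Rev 1 (r - t)).trans ((Rev 1 r).symm.trans ((normanPerm p t r).trans (Rev 1 r))) := by
  have hle : 2 * p ^ m ≤ N * p ^ m := Nat.mul_le_mul_right _ hN
  rw [normanPerm_eq_chainPerm (ZMod p) p (by omega), normanPerm_eq_chainPerm (ZMod p) p ht,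
    chainPerm_sub (X_pow_dvd_one_add_X_pow_sub_one p hr N) (by omega), chainPerm_eq_trans_Rev ht,
    chainPerm_trans_Rev_comm, Rev_symm]
  simp only [← Equiv.trans_assoc, Rev_trans_Rev ht]

end NormanPerm

end NormanPermutation

open NormanPermutation in
theorem propositionT_general (p : ℕ) [Fact p.Prime] (F : Type*) [Field F] [CharP F p]
    (m r s₀ s₁ s s' : ℕ) (hs₀ : 1 ≤ s₀) (hs₁r : s₁ ≤ r) (hr : r ≤ p ^ m)
    (hs : s = s₀ * p ^ m + s₁) (hs' : s' = (s₀ + 1) * p ^ m - s₁) :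
    (∀ σ : Equiv.Perm ℕ, IsNormanPerm F s₁ r σ ↔ σ = normanPerm p s₁ r) ∧
    (∀ σ : Equiv.Perm ℕ, IsNormanPerm F r s σ ↔ σ = normanPerm p r s) ∧
    (∀ σ : Equiv.Perm ℕ, IsNormanPerm F r s' σ ↔ σ = normanPerm p r s') ∧
    normanPerm p r s = (normanPerm p s₁ r).trans (Rev (s₁ + 1) r) ∧
    normanPerm p r s' =
      (Rev 1 (r - s₁)).trans ((Rev 1 r).symm.trans ((normanPerm p s₁ r).trans (Rev 1 r))) := by
  have hle : p ^ m ≤ s₀ * p ^ m := Nat.le_mul_of_pos_left _ hs₀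
  have hrs : r ≤ s := by omega
  have hrs' : r ≤ s' := by
    rw [add_one_mul] at hs'
    omega
  refine ⟨isNormanPerm_iff_eq_normanPerm p hs₁r, isNormanPerm_iff_eq_normanPerm p hrs,
    isNormanPerm_iff_eq_normanPerm p hrs', ?_, ?_⟩
  · rw [hs, normanPerm_mul_pow_add p hs₀ hs₁r hr]
  · rw [hs', normanPerm_mul_pow_sub p (Nat.succ_le_succ hs₀) hs₁r hr]

/-- Permutations act on the right: `f.trans g` is `f` followed by `g`, and
`g.symm.trans (f.trans g)` is the conjugate `f ^ g`. The first three conjuncts of the conclusion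
say that the three Norman permutations are well defined, over each field of characteristic `p`;
the last two are the reduction formulas. -/
theorem propositionT (p : ℕ) [Fact p.Prime] (F : Type*) [Field F] [CharP F p]
    (m r s₀ s₁ s s' : ℕ) (hs₀ : 1 ≤ s₀) (hs₀p : s₀ < p) (hs₁ : 1 ≤ s₁) (hs₁r : s₁ < r)
    (hr : r < p ^ m) (hs : s = s₀ * p ^ m + s₁) (hs' : s' = (s₀ + 1) * p ^ m - s₁) :
    (∀ σ : Equiv.Perm ℕ, NormanPermutation.IsNormanPerm F s₁ r σ ↔
      σ = NormanPermutation.normanPerm p s₁ r) ∧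
    (∀ σ : Equiv.Perm ℕ, NormanPermutation.IsNormanPerm F r s σ ↔
      σ = NormanPermutation.normanPerm p r s) ∧
    (∀ σ : Equiv.Perm ℕ, NormanPermutation.IsNormanPerm F r s' σ ↔
      σ = NormanPermutation.normanPerm p r s') ∧
    NormanPermutation.normanPerm p r s =
      (NormanPermutation.normanPerm p s₁ r).trans (NormanPermutation.Rev (s₁ + 1) r) ∧
    NormanPermutation.normanPerm p r s' =
      (NormanPermutation.Rev 1 (r - s₁)).trans
        ((NormanPermutation.Rev 1 r).symm.trans
          ((NormanPermutation.normanPerm p s₁ r).trans (NormanPermutation.Rev 1 r))) :=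
  propositionT_general p F m r s₀ s₁ s s' hs₀ hs₁r.le hr.le hs hs'
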